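/- Let $S^1=\{z\in\mathbb C : |z|=1\}$ and let $w_1,w_2,w_3,\dots$ be a sequence of integers with $w_n>1$ for all $n\ge 1$. The solenoid of type $(w_1,w_2,\dots)$ is the inverse limit of the maps $S^1\to S^1$, $x\mapsto x^{w_n}$, that is, the subspace $$\Theta=\Big\{(x_0,x_1,x_2,\dots)\in\prod_{n=0}^\infty S^1 \;:\; x_{n-1}=x_n^{w_n}\text{ for all } n\ge 1\Big\}$$ of the product space $\prod_{n=0}^\infty S^1$. Let $X$ be a topological space and let $p:X\to\Theta$ be a finite-fold covering, that is, a covering map all of whose fibres are finite. Then every connected component of $X$ is homeomorphic to $\Theta$. -/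

import Mathlib

/-- The solenoid of type `(w 0, w 1, w 2, …)`: the inverse limit of the power maps
`x ↦ x ^ w n` of the unit circle in `ℂ`, as a subset of the product `∏ n, S¹` (with the product
topology). The entry `w n` is the exponent of the bonding map from coordinate `n + 1`
to coordinate `n`. -/
def solenoid (w : ℕ → ℕ) : Set (ℕ → Circle) :=
  {x | ∀ n : ℕ, x n = x (n + 1) ^ w n}

/-!
A finite covering of the solenoid `Θ` looks, on each component, like a power map `θ ↦ θ ^ k` of
`Θ` to itself; the total space of that covering is `Θ` again.

`Θ` is a compact abelian group. It contains the dense one-parameter subgroup `line`, and the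
kernels `level w n` of the coordinate projections are arbitrarily small subgroups. Every element
of `Θ` is a product `line t * κ` with `κ ∈ level w n`, and `line t` lies in `level w n` exactly when
`t` is an integer multiple of `degree w n = w 0 * ⋯ * w (n - 1)`.

Let `p : X → Θ` be a finite covering and `x` a point of `X`; after a translation `p x = 1`. The flow
of `line` lifts to a flow `φ` on `X` (`IsCoveringMap.exists_lift_flow`). Over a small `level w M` the
covering is a finite union of sheets, and by compactness `M` can be chosen such that the
flow permutes these sheets at each return to `level w M` (`exists_sheets`). As there are finitely many
sheets, the sheet of `x` over some `level w n` returns to itself at a time `k * degree w n`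
with `k > 0`. If `k` is minimal among all such pairs `(n, k)`, then it is prime to every later exponent
`w m`, since a common factor could be cancelled by increasing `n` (`exists_minimal_return`). So the
`k`-th power map is injective on `level w n`.

If `s` is the section of `p` over `level w n` through `x`, then
`h (line t * κ) = φ (k * t) (s (κ ^ k))` is a well-defined continuous map `h : Θ → X` with
`p (h θ) = θ ^ k`, and by minimality of `k` it is injective (`exists_injective_lift_pow`). The power map
is open by the open mapping theorem for compact groups, so `h` is open. Hence its image is connected,
compact and open, so it is the component of `x`.
-/

open Filter Topology

/-! ### The solenoid as a compact group -/

/-- The solenoid as a closed subgroup of the product of circles. -/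
def solenoidGroup (w : ℕ → ℕ) : Subgroup (ℕ → Circle) where
  carrier := solenoid w
  one_mem' n := by simp
  mul_mem' {x y} hx hy n := by
    rw [Pi.mul_apply, Pi.mul_apply, mul_pow, ← hx n, ← hy n]
  inv_mem' {x} hx n := by
    rw [Pi.inv_apply, Pi.inv_apply, inv_pow, ← hx n]

namespace solenoidGroup

variable {w : ℕ → ℕ}

lemma apply_eq_pow (θ : solenoidGroup w) (n : ℕ) : θ.1 n = θ.1 (n + 1) ^ w n := θ.2 n

instance : CompactSpace (solenoidGroup w) := by
  refine isCompact_iff_compactSpace.mp (IsClosed.isCompact ?_)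
  have : ((solenoidGroup w : Subgroup (ℕ → Circle)) : Set (ℕ → Circle)) =
      ⋂ n, {x | x n = x (n + 1) ^ w n} := by
    ext x
    simp [solenoidGroup, solenoid]
  rw [this]
  exact isClosed_iInter fun n => isClosed_eq (by fun_prop) (by fun_prop)

/-- The kernel of the projection of the solenoid to its `n`-th coordinate. -/
def level (w : ℕ → ℕ) (n : ℕ) : Subgroup (solenoidGroup w) where
  carrier := {θ | θ.1 n = 1}
  one_mem' := rfl
  mul_mem' {x y} (hx : x.1 n = 1) (hy : y.1 n = 1) := by
    change x.1 n * y.1 n = 1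
    rw [hx, hy, one_mul]
  inv_mem' {x} (hx : x.1 n = 1) := by
    change (x.1 n)⁻¹ = 1
    rw [hx, inv_one]

lemma mem_level {n : ℕ} {θ : solenoidGroup w} : θ ∈ level w n ↔ θ.1 n = 1 := Iff.rfl

lemma level_antitone : Antitone (level w) := by
  refine antitone_nat_of_succ_le fun n θ hθ => ?_
  rw [mem_level] at *
  rw [apply_eq_pow, hθ, one_pow]

instance (n : ℕ) : CompactSpace (level w n) := by
  refine isCompact_iff_compactSpace.mp (IsClosed.isCompact ?_)
  have : IsClosed {θ : solenoidGroup w | θ.1 n = 1} := 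
    isClosed_eq ((continuous_apply n).comp continuous_subtype_val) continuous_const
  exact this

/-- Basic neighbourhoods in the product topology constrain finitely many coordinates, and the
coordinate `n` determines all earlier ones. -/
lemma exists_level_subset {U : Set (solenoidGroup w)} (hU : U ∈ 𝓝 1) :
    ∃ n, (level w n : Set (solenoidGroup w)) ⊆ U := by
  obtain ⟨V, hV, hVU⟩ := mem_nhds_subtype _ _ _ |>.mp hU
  obtain ⟨V', hV'V, hV'o, h1⟩ := mem_nhds_iff.mp hV
  obtain ⟨I, u, hu, hIu⟩ := isOpen_pi_iff.mp hV'o _ h1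
  refine ⟨I.sup id, fun θ hθ => hVU (hV'V (hIu fun i hi => ?_))⟩
  have : θ ∈ level w i := level_antitone (Finset.le_sup (f := id) hi) hθ
  rw [mem_level.mp this]
  exact (hu i hi).2

/-- The degree of the projection from the coordinate `n` of the solenoid to its coordinate `0`. -/
def degree (w : ℕ → ℕ) (n : ℕ) : ℕ := ∏ i ∈ Finset.range n, w i

lemma degree_succ (n : ℕ) : degree w (n + 1) = degree w n * w n := Finset.prod_range_succ ..

lemma degree_dvd {m n : ℕ} (h : m ≤ n) : degree w m ∣ degree w n :=
  Finset.prod_dvd_prod_of_subset _ _ _ (Finset.range_mono h)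

lemma degree_pos (hw : ∀ n, 0 < w n) (n : ℕ) : 0 < degree w n :=
  Finset.prod_pos fun i _ => hw i

/-- The one-parameter subgroup of the solenoid that winds once around the coordinate `0` in unit
time. -/
noncomputable def line (hw : ∀ n, 0 < w n) (t : ℝ) : solenoidGroup w :=
  ⟨fun n => Circle.exp (t / degree w n * (2 * Real.pi)), fun n => by
    have h1 : (degree w n : ℝ) ≠ 0 := by exact_mod_cast (degree_pos hw n).ne'
    have h2 : (w n : ℝ) ≠ 0 := by exact_mod_cast (hw n).ne'
    change Circle.exp _ = Circle.exp _ ^ _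
    rw [← Circle.exp_nsmul, degree_succ]
    congr 1
    push_cast
    rw [nsmul_eq_mul]
    field_simp⟩

variable (hw : ∀ n, 0 < w n)

lemma continuous_line : Continuous (line hw) := by
  refine Continuous.subtype_mk (continuous_pi fun n => ?_) _
  exact Circle.exp.continuous.comp (by fun_prop)

lemma line_add (s t : ℝ) : line hw (s + t) = line hw s * line hw t := by
  ext n : 2
  change Circle.exp _ = Circle.exp _ * Circle.exp _
  rw [← Circle.exp_add]
  ring_nf

lemma line_zero : line hw 0 = 1 := by
  simpa using line_add hw 0 0

lemma line_neg (t : ℝ) : line hw (-t) = (line hw t)⁻¹ := by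
  rw [eq_inv_iff_mul_eq_one, ← line_add, neg_add_cancel, line_zero]

lemma line_nat_mul (k : ℕ) (t : ℝ) : line hw (k * t) = line hw t ^ k := by
  induction k with
  | zero => simp [line_zero]
  | succ k ih => rw [Nat.cast_succ, add_mul, line_add, ih, one_mul, pow_succ]

lemma line_mem_level {t : ℝ} {n : ℕ} :
    line hw t ∈ level w n ↔ ∃ i : ℤ, t = i * degree w n := by
  have h1 : (degree w n : ℝ) ≠ 0 := by exact_mod_cast (degree_pos hw n).ne'
  rw [mem_level]
  change Circle.exp _ = 1 ↔ _
  rw [Circle.exp_eq_one]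
  refine exists_congr fun i => ?_
  rw [mul_left_inj' (by positivity), div_eq_iff h1]

/-- Every element of the solenoid is reached from a given `level` by flowing along `line` for a
bounded time. -/
lemma exists_line_mul (n : ℕ) (θ : solenoidGroup w) :
    ∃ t ∈ Set.Ico (0 : ℝ) (degree w n), ∃ κ ∈ level w n, line hw t * κ = θ := by
  have h1 : (0 : ℝ) < degree w n := by exact_mod_cast degree_pos hw n
  obtain ⟨a, ha⟩ := Circle.exp_surjective (θ.1 n)
  have key : ∃ b ∈ Set.Ico (0 : ℝ) (2 * Real.pi), Circle.exp b = θ.1 n := by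
    obtain ⟨b, hb, hab⟩ := Circle.periodic_exp.exists_mem_Ico₀ Real.two_pi_pos a
    exact ⟨b, hb, by rw [← hab, ha]⟩
  obtain ⟨b, hb, hbθ⟩ := key
  have hπ := Real.two_pi_pos
  refine ⟨b / (2 * Real.pi) * degree w n, ⟨?_, ?_⟩, (line hw (b / (2 * Real.pi) * degree w n))⁻¹ * θ,
    ?_, by group⟩
  · have := hb.1
    positivity
  · have : b / (2 * Real.pi) < 1 := (div_lt_one hπ).2 hb.2
    nlinarith
  · rw [mem_level]
    change (Circle.exp _)⁻¹ * θ.1 n = 1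
    rw [← hbθ, inv_mul_eq_one]
    congr 1
    field_simp

lemma denseRange_line : DenseRange (line hw) := by
  intro θ
  rw [mem_closure_iff_nhds]
  intro U hU
  have h1 : (fun κ => θ * κ⁻¹) ⁻¹' U ∈ 𝓝 (1 : solenoidGroup w) := by
    refine ContinuousAt.preimage_mem_nhds (by fun_prop) ?_
    simpa using hU
  obtain ⟨n, hn⟩ := exists_level_subset h1
  obtain ⟨t, -, κ, hκ, rfl⟩ := exists_line_mul hw n θ
  exact ⟨line hw t, by simpa using hn hκ, t, rfl⟩

include hw in
lemma connectedSpace : ConnectedSpace (solenoidGroup w) :=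
  by
  have : PreconnectedSpace (solenoidGroup w) :=
    (denseRange_line hw).preconnectedSpace (continuous_line hw)
  exact ⟨⟨1⟩⟩

include hw in
lemma pow_surjective {k : ℕ} (hk : 0 < k) :
    Function.Surjective fun θ : solenoidGroup w => θ ^ k := by
  -- the image is closed by compactness, and contains the dense one-parameter subgroup
  have hcl : IsClosed (Set.range fun θ : solenoidGroup w => θ ^ k) :=
    (isCompact_range (by fun_prop)).isClosed
  have hsub : Set.range (line hw) ⊆ Set.range fun θ : solenoidGroup w => θ ^ k := by
    rintro _ ⟨t, rfl⟩
    refine ⟨line hw (t / k), ?_⟩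
    change line hw (t / k) ^ k = _
    rw [← line_nat_mul]
    congr 1
    have : (k : ℝ) ≠ 0 := by exact_mod_cast hk.ne'
    field_simp
  intro θ
  exact closure_minimal hsub hcl (denseRange_line hw θ)

include hw in
lemma isOpenMap_pow {k : ℕ} (hk : 0 < k) : IsOpenMap fun θ : solenoidGroup w => θ ^ k :=
  (powMonoidHom k : solenoidGroup w →* solenoidGroup w).isOpenMap_of_sigmaCompact
    (pow_surjective hw hk) (by change Continuous fun θ : solenoidGroup w => θ ^ k; fun_prop)

/-- If `k` is prime to all later exponents, then `level w n` has no `k`-torsion: a coordinate that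
is killed by `k` and whose `w m`-th power is `1` is itself `1`. -/
lemma pow_injOn_level {k n : ℕ} (hk : ∀ m ≥ n, k.Coprime (w m)) :
    Set.InjOn (fun θ : solenoidGroup w => θ ^ k) (level w n) := by
  intro θ hθ η hη h
  change θ ^ k = η ^ k at h
  rw [← div_eq_one]
  have hδ : θ / η ∈ level w n := div_mem hθ hη
  have hδk : (θ / η) ^ k = 1 := by rw [div_pow, h, div_self']
  generalize θ / η = δ at hδ hδk
  have hall : ∀ m ≥ n, δ ∈ level w m := by
    intro m hm
    induction m, hm using Nat.le_induction with
    | base => exact hδ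
    | succ m hm ih =>
      have h1 : δ.1 (m + 1) ^ w m = 1 := by rw [← apply_eq_pow]; exact ih
      have h2 : δ.1 (m + 1) ^ k = 1 := congrFun (congrArg Subtype.val hδk) (m + 1)
      have := pow_gcd_eq_one.mpr ⟨h2, h1⟩
      rwa [(hk m hm).gcd_eq_one, pow_one] at this
  ext m : 2
  exact level_antitone (le_max_left m n) (hall _ (le_max_right m n))

end solenoidGroup

/-! ### Lifting a flow to a covering space -/

/-- A flow by translations along a one-parameter subgroup lifts to every covering space.
Uniqueness of path lifting yields the flow law, and the homotopy lifting property
yields joint continuity. -/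
lemma IsCoveringMap.exists_lift_flow {G X : Type*} [Group G] [TopologicalSpace G]
    [ContinuousMul G] [TopologicalSpace X] {p : X → G} (hp : IsCoveringMap p) {e : ℝ → G}
    (he : Continuous e) (he_zero : e 0 = 1) (he_add : ∀ s t, e (s + t) = e s * e t) :
    ∃ φ : ℝ → X → X, Continuous (fun z : ℝ × X => φ z.1 z.2) ∧ (∀ y, φ 0 y = y) ∧
      (∀ s t y, φ (s + t) y = φ s (φ t y)) ∧ ∀ t y, p (φ t y) = e t * p y := by
  have hlift : ∀ y : X, ∃ γ : C(ℝ, X), γ 0 = y ∧ ∀ t, p (γ t) = e t * p y := by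
    intro y
    obtain ⟨γ, ⟨h0, h⟩, -⟩ := hp.existsUnique_continuousMap_lifts
      (⟨fun t => e t * p y, by fun_prop⟩ : C(ℝ, G)) 0 y (by simp [he_zero])
    exact ⟨γ, h0, fun t => congrFun h t⟩
  choose γ hγ_zero hγ using hlift
  refine ⟨fun t y => γ y t, ?_, hγ_zero, fun s t y => ?_, fun t y => hγ y t⟩
  · -- reparametrize the paths of length `R` to the unit interval, with `R` as a parameter
    have hpc := hp.continuous
    have hcont := hp.isLocalHomeomorph.continuous_lift hp.isSeparatedMap
      (⟨fun z => e (z.1 * z.2.1) * p z.2.2, by fun_prop⟩ : C(unitInterval × (ℝ × X), G))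
      (g := fun z => γ z.2.2 (z.1 * z.2.1))
      (by ext z; exact hγ _ _) (by simpa [hγ_zero] using continuous_snd)
      (fun a => (γ a.2).continuous.comp (by fun_prop))
    have := hcont.comp (Continuous.prodMk_right (1 : unitInterval))
    simpa [Function.comp_def] using this
  · refine congrFun (hp.eq_of_comp_eq (g₁ := fun s => γ y (s + t)) (g₂ := fun s => γ (γ y t) s)
      (by fun_prop) (by fun_prop) ?_ 0 ?_) s
    · ext s
      simp only [Function.comp_apply, hγ, he_add, mul_assoc]
    · simp [hγ_zero]

/-- A locally constant function on a compact group is invariant under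
translation by small elements. -/
lemma exists_nhds_one_forall_eq {G F : Type*} [Group G] [TopologicalSpace G]
    [IsTopologicalGroup G] [CompactSpace G] [TopologicalSpace F] [DiscreteTopology F] {f : G → F}
    (hf : Continuous f) : ∃ U ∈ 𝓝 (1 : G), ∀ a b, a / b ∈ U → f a = f b := by
  have hopen : IsOpen {z : G × G | f (z.1 * z.2) = f z.2} :=
    (isOpen_discrete (Set.diagonal F)).preimage
      (f := fun z : G × G => (f (z.1 * z.2), f z.2)) (by fun_prop)
  obtain ⟨U, V, hU, -, h1U, hV, hUV⟩ := generalized_tube_lemma (s := {(1 : G)})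
    isCompact_singleton isCompact_univ hopen (by rintro ⟨a, b⟩ ⟨rfl, -⟩; simp)
  refine ⟨U, hU.mem_nhds (h1U rfl), fun a b hab => ?_⟩
  have : (a / b, b) ∈ U ×ˢ V := ⟨hab, hV trivial⟩
  simpa using hUV this

/-! ### Sheets over small levels -/

namespace solenoidGroup

variable {w : ℕ → ℕ} {X F : Type*} {p : X → solenoidGroup w}

/-- Let `t` be a finite trivialization over `level w m` and let `ψ` be a
lift of a translation by an element of `level w m`. For `n` large enough, `ψ` maps two points of
the same sheet over the same coset of `level w n` to the same sheet. -/
lemma eventually_sheet_eq [TopologicalSpace X] [TopologicalSpace F] [DiscreteTopology F]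
    [Finite F] (t : Bundle.Trivialization F p) {m : ℕ}
    (hm : (level w m : Set (solenoidGroup w)) ⊆ t.baseSet) {ψ : X → X} (hψ : Continuous ψ)
    {a : solenoidGroup w} (ha : a ∈ level w m) (hψa : ∀ y, p (ψ y) = a * p y) :
    ∀ᶠ n in atTop, ∀ y y', p y ∈ level w m → p y' ∈ level w m → p y / p y' ∈ level w n →
      (t y).2 = (t y').2 → (t (ψ y)).2 = (t (ψ y')).2 := by
  have hσ : ∀ σ : F, ∃ N, ∀ κ κ' : level w m, (κ / κ' : solenoidGroup w) ∈ level w N →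
      (t (ψ (t.toOpenPartialHomeomorph.symm (κ.1, σ)))).2 =
        (t (ψ (t.toOpenPartialHomeomorph.symm (κ'.1, σ)))).2 := by
    intro σ
    have hf : Continuous fun κ : level w m =>
        (t (ψ (t.toOpenPartialHomeomorph.symm (κ.1, σ)))).2 := by
      refine continuous_snd.comp (g := Prod.snd) (f := fun κ : level w m =>
        t (ψ (t.toOpenPartialHomeomorph.symm (κ.1, σ)))) ?_
      refine ContinuousOn.comp_continuous (g := t) (s := t.source) (f := fun κ : level w m =>
        ψ (t.toOpenPartialHomeomorph.symm (κ.1, σ))) t.toOpenPartialHomeomorph.continuousOn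
        (hψ.comp ?_) fun κ => ?_
      · refine t.toOpenPartialHomeomorph.continuousOn_symm.comp_continuous (by fun_prop) fun κ =>
          t.mem_target.2 (hm κ.2)
      · rw [t.mem_source, hψa, t.proj_symm_apply' (hm κ.2)]
        exact hm (mul_mem ha κ.2)
    obtain ⟨U, hU, hfU⟩ := exists_nhds_one_forall_eq hf
    obtain ⟨V, hV, hVU⟩ := mem_nhds_subtype _ _ _ |>.mp hU
    obtain ⟨N, hN⟩ := exists_level_subset hV
    exact ⟨N, fun κ κ' h => hfU κ κ' (hVU (hN h))⟩
  choose N hN using hσ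
  filter_upwards [eventually_all.2 fun σ => eventually_ge_atTop (N σ)]
    with n hn y y' hy hy' hyy' hc
  have h := hN (t y).2 ⟨p y, hy⟩ ⟨p y', hy'⟩ (level_antitone (hn _) hyy')
  have e1 : t.toOpenPartialHomeomorph.symm (p y, (t y).2) = y :=
    t.symm_apply_mk_proj (t.mem_source.2 (hm hy))
  have e2 : t.toOpenPartialHomeomorph.symm (p y', (t y).2) = y' := by
    rw [hc]
    exact t.symm_apply_mk_proj (t.mem_source.2 (hm hy'))
  dsimp only at h
  rwa [e1, e2] at h

/-- A finite covering of the solenoid with a lifted flow is described near the fibre over `1` by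
finitely many sheets: the label `c y` names the sheet of a point `y` over `level w M`, the section
`s` is the sheet of the base point `x`, and the flow permutes the sheets over `level w M` whenever
it returns to `level w M`. -/
lemma exists_sheets [TopologicalSpace X] {hw : ∀ n, 0 < w n} (hp : IsCoveringMap p)
    (hfin : (p ⁻¹' {1}).Finite) {x : X} (hx : p x = 1) {φ : ℝ → X → X}
    (hφ : Continuous fun z : ℝ × X => φ z.1 z.2) (hφ_zero : ∀ y, φ 0 y = y)
    (hφ_add : ∀ s t y, φ (s + t) y = φ s (φ t y)) (hpφ : ∀ t y, p (φ t y) = line hw t * p y) :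
    ∃ (M : ℕ) (c : X → p ⁻¹' {1}) (s : solenoidGroup w → X),
      ContinuousOn s (level w M) ∧ (∀ θ ∈ level w M, p (s θ) = θ ∧ c (s θ) = c x) ∧
      (∀ y, p y ∈ level w M → c y = c x → s (p y) = y) ∧
      ∀ y y', p y ∈ level w M → p y' ∈ level w M → c y = c y' →
        ∀ j : ℤ, c (φ (j * degree w M) y) = c (φ (j * degree w M) y') := by
  have : Nonempty (p ⁻¹' {1}) := ⟨⟨x, hx⟩⟩
  have : Finite (p ⁻¹' {1}) := hfin
  have : DiscreteTopology (p ⁻¹' {1}) := (hp 1).discreteTopology_fiber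
  let t := (hp 1).toTrivialization
  have h1 : (1 : solenoidGroup w) ∈ t.baseSet := (hp 1).mem_toTrivialization_baseSet
  obtain ⟨m, hm⟩ := exists_level_subset (t.open_baseSet.mem_nhds h1)
  have hφt : ∀ r, Continuous (φ r) := fun r => hφ.comp (Continuous.prodMk_right r)
  have hmem : ∀ j : ℤ, line hw (j * degree w m) ∈ level w m :=
    fun j => (line_mem_level hw).2 ⟨j, rfl⟩
  obtain ⟨M, hMm, hpos, hneg⟩ := ((eventually_ge_atTop m).and
    ((eventually_sheet_eq t hm (hφt _) (hmem 1) (hpφ _)).and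
      (eventually_sheet_eq t hm (hφt _) (hmem (-1)) (hpφ _)))).exists
  have hle := level_antitone (w := w) hMm
  -- return times to `level w M` are multiples of the return time to `level w m`,
  -- so the sheets can be followed step by step, in either direction
  have hstep : ∀ j : ℤ, ∀ y y', p y ∈ level w m → p y' ∈ level w m → p y / p y' ∈ level w M →
      (t y).2 = (t y').2 →
      (t (φ (j * degree w m) y)).2 = (t (φ (j * degree w m) y')).2 := by
    intro j
    induction j using Int.induction_on with
    | zero => simp [hφ_zero]
    | succ j ih =>
      intro y y' hy hy' hyy' hc
      have e : ∀ z, φ (((j : ℤ) + 1 : ℤ) * degree w m) z =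
          φ ((1 : ℤ) * degree w m) (φ ((j : ℤ) * degree w m) z) := fun z => by
        rw [← hφ_add]; congr 1; push_cast; ring
      rw [e, e]
      refine hpos _ _ ?_ ?_ ?_ (ih y y' hy hy' hyy' hc)
      · rw [hpφ]; exact mul_mem (hmem _) hy
      · rw [hpφ]; exact mul_mem (hmem _) hy'
      · rwa [hpφ, hpφ, mul_div_mul_left_eq_div]
    | pred j ih =>
      intro y y' hy hy' hyy' hc
      have e : ∀ z, φ ((-(j : ℤ) - 1 : ℤ) * degree w m) z =
          φ ((-1 : ℤ) * degree w m) (φ ((-(j : ℤ) : ℤ) * degree w m) z) := fun z => by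
        rw [← hφ_add]; congr 1; push_cast; ring
      rw [e, e]
      refine hneg _ _ ?_ ?_ ?_ (ih y y' hy hy' hyy' hc)
      · rw [hpφ]; exact mul_mem (hmem _) hy
      · rw [hpφ]; exact mul_mem (hmem _) hy'
      · rwa [hpφ, hpφ, mul_div_mul_left_eq_div]
  refine ⟨M, fun y => (t y).2, fun θ => t.toOpenPartialHomeomorph.symm (θ, (t x).2), ?_, ?_, ?_, ?_⟩
  · exact t.toOpenPartialHomeomorph.continuousOn_symm.comp (f := fun θ => (θ, (t x).2))
      (by fun_prop) fun κ hκ => t.mem_target.2 (hm (hle hκ))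
  · intro θ hθ
    refine ⟨t.proj_symm_apply' (hm (hle hθ)), ?_⟩
    dsimp only
    rw [t.apply_symm_apply' (hm (hle hθ))]
  · intro y hy hc
    dsimp only at hc ⊢
    rw [← hc]
    exact t.symm_apply_mk_proj (t.mem_source.2 (hm (hle hy)))
  · intro y y' hy hy' hc j
    obtain ⟨d, hd⟩ := degree_dvd (w := w) hMm
    have := hstep (j * d) y y' (hle hy) (hle hy') (div_mem hy hy') hc
    have e : ((j * d : ℤ) : ℝ) * degree w m = j * degree w M := by
      rw [hd]; push_cast; ring
    rwa [e] at this

/-- If the base point returns to its own sheet after time `k * degree w n`, then it does so after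
all integer multiples of this time. -/
lemma zmul_return {hw : ∀ n, 0 < w n} {x : X} (hx : p x = 1)
    {φ : ℝ → X → X} (hφ_zero : ∀ y, φ 0 y = y) (hφ_add : ∀ s t y, φ (s + t) y = φ s (φ t y))
    (hpφ : ∀ t y, p (φ t y) = line hw t * p y) {M : ℕ} {c : X → F}
    (hc : ∀ y y', p y ∈ level w M → p y' ∈ level w M → c y = c y' →
      ∀ j : ℤ, c (φ (j * degree w M) y) = c (φ (j * degree w M) y'))
    {n k : ℕ} (hn : M ≤ n) (hret : c (φ (k * degree w n) x) = c x) (i : ℤ) :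
    c (φ (i * (k * degree w n)) x) = c x := by
  obtain ⟨a, ha⟩ := degree_dvd (w := w) hn
  have hxM : p x ∈ level w M := by rw [hx]; exact one_mem _
  have e : ∀ i : ℤ, (i * (k * degree w n) : ℝ) = (i * (k * a) : ℤ) * degree w M := fun i => by
    rw [ha]; push_cast; ring
  have hmem : ∀ i : ℤ, p (φ (i * (k * degree w n)) x) ∈ level w M := fun i => by
    rw [hpφ, hx, mul_one]
    exact (line_mem_level hw).2 ⟨_, e i⟩
  have hnat : ∀ i : ℕ, c (φ ((i : ℤ) * (k * degree w n)) x) = c x := by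
    intro i
    induction i with
    | zero => simp [hφ_zero]
    | succ i ih =>
      have e' : (((i + 1 : ℕ) : ℤ) * (k * degree w n) : ℝ) =
          (i : ℤ) * (k * degree w n) + (1 : ℤ) * (k * degree w n) := by
        push_cast; ring
      rw [e', hφ_add, e i, hc _ x (hmem 1) hxM (by simpa using hret), ← e, ih]
  obtain ⟨m, rfl | rfl⟩ := i.eq_nat_or_neg
  · exact hnat m
  · have h := hc _ _ (hmem m) hxM (hnat m) (-m * (k * a))
    rw [← e, ← hφ_add, Int.cast_neg, neg_mul, neg_add_cancel, hφ_zero] at h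
    rw [Int.cast_neg, neg_mul, ← h]

/-- Among all return times of the base point to its own sheet there is one, of the form
`k * degree w n`, with `k` minimal. A common factor of `k` and a later exponent could be cancelled
by passing to a later level, so `k` is prime to all later exponents. -/
lemma exists_minimal_return {hw : ∀ n, 0 < w n} [Finite F] {x : X} (hx : p x = 1)
    {φ : ℝ → X → X} (hφ_zero : ∀ y, φ 0 y = y) (hφ_add : ∀ s t y, φ (s + t) y = φ s (φ t y))
    (hpφ : ∀ t y, p (φ t y) = line hw t * p y) {M : ℕ} {c : X → F}
    (hc : ∀ y y', p y ∈ level w M → p y' ∈ level w M → c y = c y' →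
      ∀ j : ℤ, c (φ (j * degree w M) y) = c (φ (j * degree w M) y')) :
    ∃ n ≥ M, ∃ k : ℕ, 0 < k ∧ c (φ (k * degree w n) x) = c x ∧ (∀ m ≥ n, k.Coprime (w m)) ∧
      ∀ i : ℕ, 0 < i → i < k → c (φ (i * degree w n) x) ≠ c x := by
  classical
  have hmem : ∀ j : ℤ, p (φ (j * degree w M) x) ∈ level w M := fun j => by
    rw [hpφ, hx, mul_one]
    exact (line_mem_level hw).2 ⟨j, rfl⟩
  have hxM : p x ∈ level w M := by rw [hx]; exact one_mem _
  have hex : ∃ k : ℕ, 0 < k ∧ ∃ n ≥ M, c (φ (k * degree w n) x) = c x := by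
    obtain ⟨i, j, hij, h⟩ :=
      Finite.exists_ne_map_eq_of_infinite fun i : ℕ => c (φ ((i : ℤ) * degree w M) x)
    wlog hlt : i < j generalizing i j
    · exact this j i hij.symm h.symm (by omega)
    refine ⟨j - i, by omega, M, le_rfl, ?_⟩
    have h2 := hc _ _ (hmem i) (hmem j) h (-i)
    rw [← hφ_add, ← hφ_add, ← add_mul, ← add_mul] at h2
    rw [Nat.cast_sub hlt.le]
    simpa [hφ_zero, neg_add_eq_sub] using h2.symm
  obtain ⟨hk, n, hn, hret⟩ := Nat.find_spec hex
  have hmin := fun i (hi : i < Nat.find hex) => Nat.find_min hex hi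
  generalize Nat.find hex = k at hk hret hmin
  refine ⟨n, hn, k, hk, hret, fun m hm => ?_, fun i hi hik h => hmin i hik ⟨hi, n, hn, h⟩⟩
  by_contra hco
  obtain ⟨d, hd, ⟨k', rfl⟩, ⟨v, hv⟩⟩ := Nat.Prime.not_coprime_iff_dvd.mp hco
  obtain ⟨b, hb⟩ := degree_dvd (w := w) hm
  have hk' : 0 < k' := Nat.pos_of_mul_pos_left hk
  refine hmin k' ?_ ⟨hk', m + 1, by omega, ?_⟩
  · exact lt_mul_of_one_lt_left hk' hd.one_lt
  · rw [← zmul_return hx hφ_zero hφ_add hpφ hc hn hret (b * v : ℕ)]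
    congr 2
    rw [degree_succ, hb, hv]
    push_cast
    ring

end solenoidGroup

/-! ### Components of finite coverings -/

lemma IsLocalHomeomorph.isOpenMap_of_comp {A B C : Type*} [TopologicalSpace A]
    [TopologicalSpace B] [TopologicalSpace C] {f : B → C} (hf : IsLocalHomeomorph f) {g : A → B}
    (hg : Continuous g) (hfg : IsOpenMap (f ∘ g)) : IsOpenMap g := by
  rw [isOpenMap_iff_nhds_le]
  intro a U hU
  obtain ⟨V, hV, hinj⟩ := isLocallyInjective_iff_nhds.mp hf.isLocallyInjective (g a)
  have h1 : (f ∘ g) '' (g ⁻¹' (U ∩ V)) ∈ 𝓝 (f (g a)) :=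
    hfg.image_mem_nhds (inter_mem hU (hg.continuousAt hV))
  filter_upwards [hf.continuous.continuousAt h1, hV] with b ⟨a', ha', hb⟩ hbV
  rw [← hinj ha'.2 hbV hb]
  exact ha'.1

namespace solenoidGroup

variable {w : ℕ → ℕ} {X : Type*} [TopologicalSpace X] {p : X → solenoidGroup w}

/-- For a finite covering `p` of the solenoid and a point `x` over `1`, some power map of the
solenoid lifts to an injective map into the covering space through `x`. The exponent `k` is that of
a minimal return of `x` to its own sheet. -/
lemma exists_injective_lift_pow (hw : ∀ n, 0 < w n) (hp : IsCoveringMap p)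
    (hfin : (p ⁻¹' {1}).Finite) {x : X} (hx : p x = 1) :
    ∃ k > 0, ∃ h : solenoidGroup w → X, Continuous h ∧ Function.Injective h ∧ h 1 = x ∧
      ∀ θ, p (h θ) = θ ^ k := by
  obtain ⟨φ, hφ, hφ_zero, hφ_add, hpφ⟩ := hp.exists_lift_flow
    (continuous_line hw) (line_zero hw) (line_add hw)
  obtain ⟨M, c, s, hs, hps, hsp, hc⟩ := exists_sheets hp hfin hx hφ hφ_zero hφ_add hpφ
  have : Finite (p ⁻¹' {1}) := hfin
  obtain ⟨n, hn, k, hk, hret, hco, hmin⟩ := exists_minimal_return hx hφ_zero hφ_add hpφ hc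
  have hle := level_antitone (w := w) hn
  obtain ⟨a, ha⟩ := degree_dvd (w := w) hn
  have hk' : (0 : ℝ) < k := by exact_mod_cast hk
  have hxM : p x ∈ level w M := by rw [hx]; exact one_mem _
  have hsx : s 1 = x := by rw [← hx]; exact hsp x hxM rfl
  -- over `level w n`, the sheet of `s` is followed by following the point `x`
  have hfollow : ∀ κ ∈ level w n, ∀ i : ℤ,
      c (φ (i * degree w n) (s κ)) = c (φ (i * degree w n) x) := by
    intro κ hκ i
    have e : (i * degree w n : ℝ) = (i * a : ℤ) * degree w M := by
      rw [ha]; push_cast; ring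
    rw [e]
    refine hc _ _ ?_ hxM (hps κ (hle hκ)).2 _
    rw [(hps κ (hle hκ)).1]
    exact hle hκ
  let g : ℝ → solenoidGroup w → X := fun t κ => φ (k * t) (s (κ ^ k))
  have hpg : ∀ t, ∀ κ ∈ level w n, p (g t κ) = (line hw t * κ) ^ k := by
    intro t κ hκ
    rw [hpφ, (hps _ (hle (pow_mem hκ k))).1, mul_pow, line_nat_mul]
  -- `g` descends along `(t, κ) ↦ line t * κ`, since the flow at time `k * degree w n` preserves
  -- the sheet of `s` over `level w n`
  have hg : ∀ t t', ∀ κ ∈ level w n, ∀ κ' ∈ level w n, line hw t * κ = line hw t' * κ' →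
      g t κ = g t' κ' := by
    intro t t' κ hκ κ' hκ' h
    have hκ'_eq : line hw (t - t') * κ = κ' := by
      rw [sub_eq_neg_add, line_add, line_neg, mul_assoc, h, inv_mul_cancel_left]
    have hmem : line hw (t - t') ∈ level w n := by
      rw [eq_div_of_mul_eq' hκ'_eq]
      exact div_mem hκ' hκ
    obtain ⟨i, hi⟩ := (line_mem_level hw).1 hmem
    have e : (k * t : ℝ) = k * t' + (k * i : ℤ) * degree w n := by
      rw [eq_add_of_sub_eq' hi]; push_cast; ring
    have e' : ((k * i : ℤ) * degree w n : ℝ) = i * (k * degree w n) := by push_cast; ring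
    have hpy : p (φ ((k * i : ℤ) * degree w n) (s (κ ^ k))) = κ' ^ k := by
      have e'' : ((k * i : ℤ) * degree w n : ℝ) = k * (t - t') := by rw [hi]; push_cast; ring
      rw [hpφ, (hps _ (hle (pow_mem hκ k))).1, e'', line_nat_mul, ← mul_pow, hκ'_eq]
    change φ (k * t) (s (κ ^ k)) = φ (k * t') (s (κ' ^ k))
    rw [e, hφ_add, ← hpy, hsp]
    · rw [hpy]
      exact hle (pow_mem hκ' k)
    · rw [hfollow _ (pow_mem hκ k), e']
      exact zmul_return hx hφ_zero hφ_add hpφ hc hn hret i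
  choose T hT K hK hTK using exists_line_mul hw n
  let h : solenoidGroup w → X := fun θ => g (T θ) (K θ)
  have hh : ∀ t, ∀ κ ∈ level w n, h (line hw t * κ) = g t κ := fun t κ hκ =>
    hg _ _ _ (hK _) _ hκ (hTK _)
  have hph : ∀ θ, p (h θ) = θ ^ k := fun θ => by rw [hpg _ _ (hK θ), hTK]
  refine ⟨k, hk, h, ?_, ?_, ?_, hph⟩
  · let q : Set.Icc (0 : ℝ) (degree w n) × level w n → solenoidGroup w :=
      fun z => line hw z.1 * z.2
    have hq : Continuous q :=
      ((continuous_line hw).comp (by fun_prop)).mul (by fun_prop)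
    have hq_surj : Function.Surjective q := fun θ =>
      ⟨(⟨T θ, Set.Ico_subset_Icc_self (hT θ)⟩, ⟨K θ, hK θ⟩), hTK θ⟩
    refine (hq.isClosedMap.isQuotientMap hq hq_surj).continuous_iff.2 ?_
    have e : h ∘ q = fun z => φ (k * z.1) (s (z.2 ^ k)) := by
      ext z
      exact hh _ _ z.2.2
    rw [e]
    refine hφ.comp (Continuous.prodMk (by fun_prop) ?_)
    exact hs.comp_continuous (by fun_prop) fun z => hle (pow_mem z.2.2 k)
  · intro θ η hθη
    wlog hlt : T η ≤ T θ generalizing θ η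
    · exact (this hθη.symm (le_of_not_ge hlt)).symm
    change φ (k * T θ) (s (K θ ^ k)) = φ (k * T η) (s (K η ^ k)) at hθη
    have h1 : φ (k * (T θ - T η)) (s (K θ ^ k)) = s (K η ^ k) := by
      rw [mul_sub, sub_eq_neg_add, hφ_add, hθη, ← hφ_add, neg_add_cancel, hφ_zero]
    have h2 : line hw (k * (T θ - T η)) * K θ ^ k = K η ^ k := by
      have := congrArg p h1
      rwa [hpφ, (hps _ (hle (pow_mem (hK _) k))).1, (hps _ (hle (pow_mem (hK _) k))).1] at this
    have h3 : line hw (k * (T θ - T η)) ∈ level w n := by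
      rw [eq_div_of_mul_eq' h2]
      exact div_mem (pow_mem (hK _) k) (pow_mem (hK _) k)
    obtain ⟨i, hi⟩ := (line_mem_level hw).1 h3
    have hd : (0 : ℝ) < degree w n := by exact_mod_cast degree_pos hw n
    have hi0 : 0 ≤ i := by
      have : (0 : ℝ) ≤ i * degree w n := by rw [← hi]; exact mul_nonneg hk'.le (sub_nonneg.2 hlt)
      exact_mod_cast nonneg_of_mul_nonneg_left this hd
    lift i to ℕ using hi0
    have hik : i < k := by
      have : (i : ℝ) * degree w n < k * degree w n := by
        rw [← Int.cast_natCast, ← hi]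
        exact mul_lt_mul_of_pos_left (by linarith [(hT θ).2, (hT η).1]) hk'
      exact_mod_cast lt_of_mul_lt_mul_right this hd.le
    have hci : c (φ (i * degree w n) x) = c x := by
      have := hfollow _ (pow_mem (hK θ) k) i
      rw [← hi, h1, (hps _ (hle (pow_mem (hK _) k))).2, hi] at this
      exact_mod_cast this.symm
    -- by minimality of `k` no time has elapsed
    obtain rfl : i = 0 := by
      by_contra hne
      exact hmin i (Nat.pos_of_ne_zero hne) hik hci
    have hTT : T θ = T η := by
      have : (k : ℝ) * (T θ - T η) = 0 := by simpa using hi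
      exact sub_eq_zero.1 ((mul_eq_zero.1 this).resolve_left hk'.ne')
    have hKK : K θ = K η := by
      refine pow_injOn_level hco (hK θ) (hK η) ?_
      simpa [hTT, line_zero] using h2
    rw [← hTK θ, ← hTK η, hTT, hKK]
  · have := hh 0 1 (one_mem _)
    rw [line_zero, one_mul] at this
    rw [this]
    simp [g, hφ_zero, hsx]

/-- The injective lift of a power map is an open embedding onto the component. -/
lemma nonempty_connectedComponent_homeomorph (hw : ∀ n, 0 < w n) (hp : IsCoveringMap p)
    (hfin : (p ⁻¹' {1}).Finite) {x : X} (hx : p x = 1) :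
    Nonempty (connectedComponent x ≃ₜ solenoidGroup w) := by
  obtain ⟨k, hk, h, hcont, hinj, rfl, hph⟩ := exists_injective_lift_pow hw hp hfin hx
  have hopen : IsOpenMap h :=
    hp.isLocalHomeomorph.isOpenMap_of_comp hcont <| by
      rw [show p ∘ h = fun θ => θ ^ k from funext hph]
      exact isOpenMap_pow hw hk
  have : ConnectedSpace (solenoidGroup w) := connectedSpace hw
  have : T2Space X := by
    refine ⟨fun y z hyz => ?_⟩
    by_cases hp_eq : p y = p z
    · exact hp.isSeparatedMap y z hp_eq hyz
    · exact separated_by_continuous hp.continuous hp_eq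
  have hrange : Set.range h = connectedComponent (h 1) := by
    refine (isPreconnected_range hcont).subset_connectedComponent ⟨1, rfl⟩ |>.antisymm ?_
    refine IsClopen.connectedComponent_subset ⟨?_, hopen.isOpen_range⟩ ⟨1, rfl⟩
    exact (isCompact_range hcont).isClosed
  rw [← hrange]
  exact ⟨(IsOpenEmbedding.of_continuous_injective_isOpenMap hcont hinj hopen).toHomeomorph.symm⟩

end solenoidGroup

theorem theorem2 (w : ℕ → ℕ) (hw : ∀ n, 1 < w n)
    {X : Type*} [TopologicalSpace X] (p : X → solenoid w)
    (hp : IsCoveringMap p) (hfin : ∀ θ : solenoid w, (p ⁻¹' {θ}).Finite) (x : X) :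
    Nonempty (connectedComponent x ≃ₜ solenoid w) := by
  let p' : X → solenoidGroup w := p
  have hp' : IsCoveringMap p' := hp
  -- translate the base point to the identity
  have hq := hp'.homeomorph_comp (Homeomorph.mulLeft (p' x)⁻¹)
  refine solenoidGroup.nonempty_connectedComponent_homeomorph (fun n => (hw n).le) hq ?_ (x := x)
    (inv_mul_cancel _)
  convert hfin (p x) using 1
  ext y
  exact inv_mul_eq_one.trans eq_comm
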